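/- Let $X$ be a connected compact metric space (non-empty) with metric $\rho$, and let $f:[0,\infty)\times X\to X$ be a semiflow of homeomorphisms: $f$ is continuous, each $f(t,\cdot)$ is a homeomorphism of $X$ onto a subset of $X$, $f(0,x)=x$ and $f(t,f(t',x))=f(t+t',x)$ for all $t,t'\ge 0$, $x\in X$. Fix $T>0$. For $\varepsilon>0$ and $x\in X$, an $(x,\varepsilon)$-motion is a (not necessarily continuous) map $g:[0,\infty)\to X$ with $g(0)=x$ and $$\rho\bigl(g(t+\tau),f(\tau,g(t))\bigr)<\varepsilon\qquad\text{for all } t\ge 0,\ \tau\in[0,T].$$ A point $y$ is an $\omega$-limit point of $g$ if $g(t_i)\to y$ for some sequence $t_i\to\infty$. Let $\omega^\varepsilon(x)$ be the set of all $\omega$-limit points of all $(x,\varepsilon)$-motions, and put $$\omega^0(x)=\bigcap_{\varepsilon>0}\omega^\varepsilon(x),\qquad \omega^\varepsilon_f=\bigcup_{x\in X}\omega^\varepsilon(x),\qquad \omega^0_f=\bigcup_{x\in X}\omega^0(x).$$ With $\rho^*(z,W)=\inf_{w\in W}\rho(z,w)$, define for an $(x,\varepsilon)$-motion $g$ and $\gamma>0$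 the relaxation times $$\tau_1^\varepsilon(g,\gamma)=\inf\{t\ge 0:\rho^*(g(t),\omega^\varepsilon(x))<\gamma\},$$ $$\tau_2^\varepsilon(g,\gamma)=\overline{\mathrm{mes}}\{t\ge 0:\rho^*(g(t),\omega^\varepsilon(x))\ge\gamma\},$$ $$\tau_3^\varepsilon(g,\gamma)=\inf\{t\ge 0:\rho^*(g(t'),\omega^\varepsilon(x))<\gamma\text{ for all }t'>t\},$$ $$\eta_3^\varepsilon(g,\gamma)=\inf\{t\ge 0:\rho^*(g(t'),\omega^\varepsilon_f)<\gamma\text{ for all }t'>t\},$$ where $\overline{\mathrm{mes}}$ is the outer Lebesgue measure. The semiflow $f$ possesses $\tau^0_i$-slow relaxations (respectively $\eta^0_3$-slow relaxations) if there are $\gamma>0$, numbers $\varepsilon_j>0$ with $\varepsilon_j\to 0$, points $x_j\in X$ and $(x_j,\varepsilon_j)$-motions $g_j$ such that $\tau_i^{\varepsilon_j}(g_j,\gamma)\to\infty$ (respectively $\eta_3^{\varepsilon_j}(g_j,\gamma)\to\infty$) as $j\to\infty$. **Theorem 4.6.** If $\omega^0_f$ is connected, then $f$ possesses none of $\tau^0_1$-,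 $\tau^0_2$-, $\tau^0_3$- and $\eta^0_3$-slow relaxations. If $\omega^0_f$ is disconnected, then $f$ possesses all four of them: $\tau^0_1$-, $\tau^0_2$-, $\tau^0_3$- and $\eta^0_3$-slow relaxations. -/

import Mathlib

open Filter
open scoped NNReal ENNReal Topology

namespace Perturbed

variable {X : Type*} [MetricSpace X]

/-- Here `f : Flow ℝ≥0 X` is a jointly continuous semiflow on `X` (time `t ≥ 0`).
`IsEpsMotion f T ε x g` says that the (possibly discontinuous) map `g : [0,∞) → X` is an
`(x, ε, T)`-motion of `f`: it starts at `x` and on every time window of length at most `T`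
it departs from the true motion by less than `ε`. -/
def IsEpsMotion (f : Flow ℝ≥0 X) (T : ℝ≥0) (ε : ℝ) (x : X) (g : ℝ≥0 → X) : Prop :=
  g 0 = x ∧ ∀ t τ : ℝ≥0, τ ≤ T → dist (g (t + τ)) (f τ (g t)) < ε

/-- The `ω`-limit points of an arbitrary map `g : [0,∞) → X`. -/
def limitPoints (g : ℝ≥0 → X) : Set X :=
  {y | ∃ s : ℕ → ℝ≥0, Tendsto s atTop atTop ∧ Tendsto (fun n => g (s n)) atTop (𝓝 y)}

/-- `ω^ε(x)`: all `ω`-limit points of all `(x, ε, T)`-motions. -/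
def omegaEps (f : Flow ℝ≥0 X) (T : ℝ≥0) (ε : ℝ) (x : X) : Set X :=
  {y | ∃ g : ℝ≥0 → X, IsEpsMotion f T ε x g ∧ y ∈ limitPoints g}

/-- `ω^0(x) = ⋂_{ε > 0} ω^ε(x)`. -/
def omegaZero (f : Flow ℝ≥0 X) (T : ℝ≥0) (x : X) : Set X :=
  {y | ∀ ε : ℝ, 0 < ε → y ∈ omegaEps f T ε x}

/-- The total set `ω^ε_f = ⋃_x ω^ε(x)`. -/
def totalOmegaEps (f : Flow ℝ≥0 X) (T : ℝ≥0) (ε : ℝ) : Set X :=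
  ⋃ x : X, omegaEps f T ε x

/-- The total set `ω^0_f = ⋃_x ω^0(x)`. -/
def totalOmegaZero (f : Flow ℝ≥0 X) (T : ℝ≥0) : Set X :=
  ⋃ x : X, omegaZero f T x

/-- Time of the first entry of `g` into the `γ`-neighbourhood of `W`. -/
noncomputable def firstEntry (g : ℝ≥0 → X) (W : Set X) (γ : ℝ) : ℝ≥0∞ :=
  ⨅ (t : ℝ≥0) (_ : Metric.infDist (g t) W < γ), (t : ℝ≥0∞)

/-- Outer Lebesgue measure of the set of times that `g` spends outside the
`γ`-neighbourhood of `W` (a Mathlib measure is the outer measure on non-measurable sets). -/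
noncomputable def timeOutside (g : ℝ≥0 → X) (W : Set X) (γ : ℝ) : ℝ≥0∞ :=
  MeasureTheory.volume ((fun t : ℝ≥0 => (t : ℝ)) '' {t | γ ≤ Metric.infDist (g t) W})

/-- Time of the final entry of `g` into the `γ`-neighbourhood of `W`. -/
noncomputable def finalEntry (g : ℝ≥0 → X) (W : Set X) (γ : ℝ) : ℝ≥0∞ :=
  ⨅ (t : ℝ≥0) (_ : ∀ t' : ℝ≥0, t < t' → Metric.infDist (g t') W < γ), (t : ℝ≥0∞)

/-- Given a relaxation time `R ε x g γ` of an `(x, ε, T)`-motion `g` with accuracy `γ`: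
for some `γ > 0` there are `(x_j, ε_j, T)`-motions with `ε_j → 0` along which it tends to
infinity. -/
def SlowRelaxations (f : Flow ℝ≥0 X) (T : ℝ≥0)
    (R : ℝ → X → (ℝ≥0 → X) → ℝ → ℝ≥0∞) : Prop :=
  ∃ γ : ℝ, 0 < γ ∧ ∃ (ε : ℕ → ℝ) (x : ℕ → X) (g : ℕ → ℝ≥0 → X),
    (∀ j, 0 < ε j) ∧ Tendsto ε atTop (𝓝 0) ∧
    (∀ j, IsEpsMotion f T (ε j) (x j) (g j)) ∧
    Tendsto (fun j => R (ε j) (x j) (g j) γ) atTop (𝓝 ⊤)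

/-- `τ⁰₁`-slow relaxations. -/
def TauOneSlow (f : Flow ℝ≥0 X) (T : ℝ≥0) : Prop :=
  SlowRelaxations f T fun ε x g γ => firstEntry g (omegaEps f T ε x) γ

/-- `τ⁰₂`-slow relaxations. -/
def TauTwoSlow (f : Flow ℝ≥0 X) (T : ℝ≥0) : Prop :=
  SlowRelaxations f T fun ε x g γ => timeOutside g (omegaEps f T ε x) γ

/-- `τ⁰₃`-slow relaxations. -/
def TauThreeSlow (f : Flow ℝ≥0 X) (T : ℝ≥0) : Prop :=
  SlowRelaxations f T fun ε x g γ => finalEntry g (omegaEps f T ε x) γ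

/-- `η⁰₃`-slow relaxations. -/
def EtaThreeSlow (f : Flow ℝ≥0 X) (T : ℝ≥0) : Prop :=
  SlowRelaxations f T fun ε _ g γ => finalEntry g (totalOmegaEps f T ε) γ

end Perturbed

/-!
A point `y` lies in `ω^0(x)` exactly when, for every `δ > 0`, a `δ`-chain leads from `x` to `y` and
another one from `y` back to itself; thus `ω^0_f` is the chain recurrent set. Limits of longer and
longer motions with errors tending to `0` lie on complete backward orbits, and the points with a
backward orbit form the global attractor `⋂ t, f t (X)`, which is connected and contains `ω^0_f`.

If `ω^0_f` is connected, then all its points are joined by chains in both directions. A backward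
orbit comes by chains from the recurrent set and returns to it, so it is itself recurrent and, being
reachable from everywhere, is contained in every `ω^ε(x)`: no relaxation is slow. If `ω^0_f` is
disconnected, it is not the whole attractor, so some backward orbit `z` starts off `ω^0_f`. The true
orbits of `z j` take the time `j T` to arrive at `z 0`, which is far from `ω^0_f`, and until then
they stay in the closed set of points from which `z 0` is reachable, while `ω^0(z j)` lies in the
disjoint closed set of points reachable from `z 0`.
-/

namespace Perturbed

section Preliminaries

theorem isConnected_iInter_of_directed {X ι : Type*} [TopologicalSpace X] [T2Space X] [Nonempty ι]
    {V : ι → Set X} (hV : Directed (· ⊇ ·) V) (hcpt : ∀ i, IsCompact (V i))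
    (hconn : ∀ i, IsConnected (V i)) : IsConnected (⋂ i, V i) := by
  have hI : IsCompact (⋂ i, V i) := (hcpt (Classical.arbitrary ι)).of_isClosed_subset
    (isClosed_iInter fun i => (hcpt i).isClosed) (Set.iInter_subset _ _)
  refine ⟨IsCompact.nonempty_iInter_of_directed_nonempty_isCompact_isClosed V hV
    (fun i => (hconn i).nonempty) hcpt fun i => (hcpt i).isClosed, ?_⟩
  refine (isPreconnected_iff_subset_of_fully_disjoint_closed hI.isClosed).2
    fun A B hA hB hAB hd => ?_
  obtain ⟨U, W, hU, hW, hAU, hBW, hUW⟩ := SeparatedNhds.of_isCompact_isCompact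
    (hI.inter_right hA) (hI.inter_right hB) (hd.mono Set.inter_subset_right Set.inter_subset_right)
  obtain ⟨i, hi⟩ := exists_subset_nhds_of_isCompact hV hcpt fun x hx =>
    (hU.union hW).mem_nhds ((hAB hx).imp (fun h => hAU ⟨hx, h⟩) fun h => hBW ⟨hx, h⟩)
  refine ((hconn i).isPreconnected.subset_or_subset hU hW hUW hi).imp (fun h x hx => ?_)
    fun h x hx => ?_
  · exact (hAB hx).resolve_right fun hxB =>
      Set.disjoint_left.1 hUW (h (Set.mem_iInter.1 hx i)) (hBW ⟨hx, hxB⟩)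
  · exact (hAB hx).resolve_left fun hxA =>
      Set.disjoint_left.1 hUW (hAU ⟨hx, hxA⟩) (h (Set.mem_iInter.1 hx i))

theorem eventually_disjoint_of_isCompact {X : Type*} [TopologicalSpace X] {W : ℝ → Set X}
    (hW : Monotone W) {K : Set X} (hK : IsCompact K)
    (h : ∀ p ∈ K, ∃ ε > 0, p ∉ closure (W ε)) : ∀ᶠ ε in 𝓝[>] 0, Disjoint K (W ε) := by
  refine hK.induction_on (p := fun S => ∀ᶠ ε in 𝓝[>] 0, Disjoint S (W ε)) (by simp)
    (fun _ _ hst ht => ht.mono fun _ => .mono_left hst)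
    (fun _ _ hs ht => (hs.and ht).mono fun _ h => Set.disjoint_union_left.2 h) fun p hp => ?_
  obtain ⟨ε, hε, hpε⟩ := h p hp
  refine ⟨(closure (W ε))ᶜ,
    mem_nhdsWithin_of_mem_nhds (isClosed_closure.isOpen_compl.mem_nhds hpε), ?_⟩
  filter_upwards [Ioo_mem_nhdsGT hε] with ε' hε'
  exact Set.disjoint_compl_left_iff_subset.2 ((hW hε'.2.le).trans subset_closure)

theorem le_infDist_of_disjoint_cthickening {X : Type*} [PseudoMetricSpace X] {S W : Set X} {γ : ℝ}
    {p : X} (hW : W.Nonempty) (h : Disjoint (Metric.cthickening γ S) W) (hp : p ∈ S) :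
    γ ≤ Metric.infDist p W := by
  refine (Metric.le_infDist hW).2 fun q hq => le_of_not_gt fun hlt => ?_
  exact Set.disjoint_left.1 h
    (Metric.mem_cthickening_of_dist_le q p γ S hp (by rw [dist_comm]; exact hlt.le)) hq

theorem exists_eqOn_Ico {α β : Type*} [LinearOrder α] [Nonempty β] {s : ℕ → α} (hs : Monotone s)
    (h : ℕ → α → β) : ∃ g : α → β, ∀ n, Set.EqOn g (h n) (Set.Ico (s n) (s (n + 1))) := by
  classical
  refine ⟨fun u => if hu : ∃ n, u ∈ Set.Ico (s n) (s (n + 1)) then h hu.choose u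
    else Classical.arbitrary β, fun n u hu => ?_⟩
  have hex : ∃ n, u ∈ Set.Ico (s n) (s (n + 1)) := ⟨n, hu⟩
  have hn : hex.choose = n := by
    by_contra hne
    exact Set.disjoint_left.1 (hs.pairwise_disjoint_on_Ico_succ hne) hex.choose_spec hu
  simp only [dif_pos hex, hn]

theorem exists_iterate_comp_of_transGen {α : Type*} {r : α → α → Prop} {x y : α}
    (h : Relation.TransGen r x y) : ∃ n : ℕ, (Relation.Comp r)^[n] r x y := by
  induction h using Relation.TransGen.head_induction_on with
  | single hxy => exact ⟨0, hxy⟩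
  | head hxz _ ih =>
    obtain ⟨n, hn⟩ := ih
    refine ⟨n + 1, ?_⟩
    rw [Function.iterate_succ_apply']
    exact ⟨_, hxz, hn⟩

theorem exists_seq_frequently_eq {α : Type*} {r : α → α → Prop} {x y : α}
    (hxy : Relation.TransGen r x y) (hyy : Relation.TransGen r y y) :
    ∃ z : ℕ → α, z 0 = x ∧ (∀ i, r (z i) (z (i + 1))) ∧ ∃ᶠ i in atTop, z i = y := by
  obtain ⟨m, hm⟩ := exists_iterate_comp_of_transGen hxy
  obtain ⟨n, hn⟩ := exists_iterate_comp_of_transGen hyy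
  -- A state records the current point together with the number of steps left until `y`.
  let State := {p : α × ℕ // (Relation.Comp r)^[p.2] r p.1 y}
  have exists_next : ∀ p : State, ∃ q : State, r p.1.1 q.1.1 ∧ (q.1.1 = y ∨ q.1.2 < p.1.2) := by
    rintro ⟨⟨a, _ | k⟩, hk⟩
    · exact ⟨⟨(y, n), hn⟩, hk, .inl rfl⟩
    · rw [Function.iterate_succ_apply'] at hk
      obtain ⟨b, hab, hb⟩ := hk
      exact ⟨⟨(b, k), hb⟩, hab, .inr k.lt_succ_self⟩
  choose next hstep hnext using exists_next
  have returns : ∀ (k : ℕ) (p : State), p.1.2 = k → ∃ i, (next^[i + 1] p).1.1 = y := by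
    intro k
    induction k using Nat.strong_induction_on with
    | h k ih =>
      rintro p rfl
      rcases hnext p with hy | hlt
      · exact ⟨0, hy⟩
      · obtain ⟨i, hi⟩ := ih _ hlt (next p) rfl
        exact ⟨i + 1, hi⟩
  refine ⟨fun i => (next^[i] ⟨(x, m), hm⟩).1.1, rfl, fun i => ?_,
    frequently_atTop.2 fun a => ?_⟩
  · simp only [Function.iterate_succ_apply']
    exact hstep _
  · obtain ⟨i, hi⟩ := returns _ (next^[a] ⟨(x, m), hm⟩) rfl
    exact ⟨i + 1 + a, le_add_self, by simpa only [Function.iterate_add_apply]⟩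

end Preliminaries

variable {X : Type*} [MetricSpace X] {f : Flow ℝ≥0 X} {T : ℝ≥0}

section Motions

theorem IsEpsMotion.mono {ε ε' : ℝ} {x : X} {g : ℝ≥0 → X} (hg : IsEpsMotion f T ε x g)
    (h : ε ≤ ε') : IsEpsMotion f T ε' x g :=
  ⟨hg.1, fun t τ hτ => (hg.2 t τ hτ).trans_le h⟩

theorem isEpsMotion_orbit {ε : ℝ} (hε : 0 < ε) (x : X) :
    IsEpsMotion f T ε x fun t => f t x := by
  refine ⟨f.map_zero_apply x, fun t τ _ => ?_⟩
  rwa [← f.map_add, add_comm, dist_self]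

theorem isEpsMotion_of_jumps (hT : 0 < T) {ε η : ℝ}
    (hε : 0 < ε) (hη : ∀ t ≤ T, ∀ x y : X, dist x y < η → dist (f t x) (f t y) < ε)
    {s : ℕ → ℝ≥0} (hs0 : s 0 = 0) (hsT : ∀ n, s n + T ≤ s (n + 1)) (hs : Tendsto s atTop atTop)
    {z : ℕ → X} (hz : ∀ n, dist (f (s (n + 1) - s n) (z n)) (z (n + 1)) < η) {g : ℝ≥0 → X}
    (hg : ∀ n, Set.EqOn g (fun u => f (u - s n) (z n)) (Set.Ico (s n) (s (n + 1)))) :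
    IsEpsMotion f T ε (z 0) g := by
  have hcover : ⋃ n, Set.Ico (s n) (s (n + 1)) = Set.univ := by
    simpa [hs0] using iUnion_Ico_map_succ_eq_Ici (f := s) (by simp [hs0])
      (not_bddAbove_of_tendsto_atTop hs)
  refine ⟨?_, fun u τ hτ => ?_⟩
  · have h0 : (0 : ℝ≥0) ∈ Set.Ico (s 0) (s 1) :=
      ⟨hs0.le, hT.trans_le (by simpa [hs0] using hsT 0)⟩
    simpa [hs0, f.map_zero_apply] using hg 0 h0
  obtain ⟨n, hn⟩ := Set.mem_iUnion.1 (hcover ▸ Set.mem_univ u)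
  rw [hg n hn, ← f.map_add]
  rcases lt_or_ge (u + τ) (s (n + 1)) with h | h
  · rwa [hg n ⟨hn.1.trans le_self_add, h⟩, add_comm τ, tsub_add_eq_add_tsub hn.1, dist_self]
  · obtain ⟨b, hb⟩ := exists_add_of_le h
    have hbτ : b < τ := by
      refine lt_of_add_lt_add_left (a := s (n + 1)) ?_
      rw [← hb]
      gcongr
      exact hn.2
    have hmem : u + τ ∈ Set.Ico (s (n + 1)) (s (n + 2)) := by
      refine ⟨h, lt_of_lt_of_le ?_ (hsT (n + 1))⟩
      rw [hb]
      gcongr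
      exact hbτ.trans_le hτ
    have hgu : g (u + τ) = f b (z (n + 1)) := by
      simpa only [hb, add_tsub_cancel_left] using hg (n + 1) hmem
    have htime : τ + (u - s n) = b + (s (n + 1) - s n) := by
      rw [add_comm, tsub_add_eq_add_tsub hn.1, hb, add_comm b,
        tsub_add_eq_add_tsub (hn.1.trans hn.2.le)]
    rw [hgu, htime, f.map_add, dist_comm]
    exact hη b (hbτ.le.trans hτ) _ _ (hz n)

theorem omegaEps_mono (x : X) : Monotone fun ε => omegaEps f T ε x :=
  fun _ _ h _ ⟨g, hg, hy⟩ => ⟨g, hg.mono h, hy⟩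

theorem totalOmegaEps_mono : Monotone (totalOmegaEps f T) :=
  fun _ _ h => Set.iUnion_mono fun x => omegaEps_mono x h

theorem omegaEps_subset_totalOmegaEps (ε : ℝ) (x : X) : omegaEps f T ε x ⊆ totalOmegaEps f T ε :=
  Set.subset_iUnion _ x

theorem frequently_dist_lt_of_mem_limitPoints {g : ℝ≥0 → X} {y : X} (hy : y ∈ limitPoints g)
    {η : ℝ} (hη : 0 < η) : ∃ᶠ t in atTop, dist (g t) y < η := by
  obtain ⟨s, hs, hgs⟩ := hy
  exact hs.frequently (hgs.eventually (Metric.ball_mem_nhds y hη)).frequently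

theorem eventually_dist_flow_lt [CompactSpace X] (f : Flow ℝ≥0 X) (S : ℝ≥0) {ε : ℝ} (hε : 0 < ε) :
    ∀ᶠ η in 𝓝[>] 0, ∀ t ≤ S, ∀ x y : X, dist x y < η → dist (f t x) (f t y) < ε := by
  have huc : UniformContinuousOn (fun p : ℝ≥0 × X => f p.1 p.2) (Set.Icc 0 S ×ˢ Set.univ) :=
    (isCompact_Icc.prod isCompact_univ).uniformContinuousOn_of_continuous
      (f.continuous continuous_fst continuous_snd).continuousOn
  obtain ⟨η₀, hη₀, h⟩ := Metric.uniformContinuousOn_iff.1 huc ε hε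
  filter_upwards [Ioo_mem_nhdsGT hη₀] with η hη t ht x y hxy
  refine h (t, x) ⟨⟨zero_le, ht⟩, trivial⟩ (t, y) ⟨⟨zero_le, ht⟩, trivial⟩ ?_
  simpa [Prod.dist_eq] using hxy.trans hη.2

theorem omegaZero_nonempty [CompactSpace X] (f : Flow ℝ≥0 X) (T : ℝ≥0) (x : X) :
    (omegaZero f T x).Nonempty := by
  obtain ⟨y, φ, hφ, hy⟩ := CompactSpace.tendsto_subseq fun n : ℕ => f n x
  exact ⟨y, fun ε hε => ⟨_, isEpsMotion_orbit hε x, fun n => φ n,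
    tendsto_natCast_atTop_atTop.comp hφ.tendsto_atTop, hy⟩⟩

theorem omegaEps_nonempty [CompactSpace X] {ε : ℝ} (hε : 0 < ε) (x : X) :
    (omegaEps f T ε x).Nonempty :=
  have ⟨y, hy⟩ := omegaZero_nonempty f T x
  ⟨y, hy ε hε⟩

end Motions

section Chains

/-- One step of a chain from `x` to `y`: flow for a time in `[T, 2T]`, then jump by less than `δ`.
Every time that is at least `T` is a sum of times in `[T, 2T]`, and the upper bound makes the flow
equicontinuous over a single step. -/
def ChainStep (f : Flow ℝ≥0 X) (T : ℝ≥0) (δ : ℝ) (x y : X) : Prop :=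
  ∃ t : ℝ≥0, T ≤ t ∧ t ≤ 2 * T ∧ dist (f t x) y < δ

/-- There is a `δ`-chain, with at least one step, from `x` to `y`. -/
def EpsChain (f : Flow ℝ≥0 X) (T : ℝ≥0) (δ : ℝ) : X → X → Prop :=
  Relation.TransGen (ChainStep f T δ)

/-- Conley's chain relation: `δ`-chains lead from `x` to `y` for every `δ > 0`. The chain recurrent
points are those with `ChainReach f T x x`. -/
def ChainReach (f : Flow ℝ≥0 X) (T : ℝ≥0) (x y : X) : Prop :=
  ∀ δ : ℝ, 0 < δ → EpsChain f T δ x y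

theorem ChainReach.trans {x y z : X} (hxy : ChainReach f T x y) (hyz : ChainReach f T y z) :
    ChainReach f T x z :=
  fun δ hδ => Relation.TransGen.trans (hxy δ hδ) (hyz δ hδ)

theorem ChainStep.mono {δ δ' : ℝ} (h : δ ≤ δ') : ChainStep f T δ ≤ ChainStep f T δ' :=
  fun _ _ ⟨t, hTt, htT, hd⟩ => ⟨t, hTt, htT, hd.trans_le h⟩

theorem EpsChain.of_dist_right_lt {δ η : ℝ} {x y y' : X} (h : EpsChain f T δ x y)
    (hy : dist y y' < η) : EpsChain f T (δ + η) x y' := by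
  obtain ⟨w, hxw, t, hTt, htT, hwy⟩ := Relation.TransGen.tail'_iff.1 h
  have hδ : δ ≤ δ + η := le_add_of_nonneg_right (dist_nonneg.trans hy.le)
  refine Relation.TransGen.tail'_iff.2
    ⟨w, Relation.ReflTransGen.mono (ChainStep.mono hδ) _ _ hxw, t, hTt, htT, ?_⟩
  linarith [dist_triangle (f t w) y y']

theorem EpsChain.of_dist_left_lt {δ η ε : ℝ} {x x' y : X} (h : EpsChain f T δ x y)
    (hη : ∀ t ≤ 2 * T, ∀ x y : X, dist x y < η → dist (f t x) (f t y) < ε)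
    (hx : dist x x' < η) : EpsChain f T (δ + ε) x' y := by
  obtain ⟨w, ⟨t, hTt, htT, hxw⟩, hwy⟩ := Relation.TransGen.head'_iff.1 h
  have hxx' := hη t htT x x' hx
  have hδ : δ ≤ δ + ε := le_add_of_nonneg_right (dist_nonneg.trans hxx'.le)
  refine Relation.TransGen.head'_iff.2 ⟨w, ⟨t, hTt, htT, ?_⟩,
    Relation.ReflTransGen.mono (ChainStep.mono hδ) _ _ hwy⟩
  linarith [dist_triangle_left (f t x') w (f t x)]

theorem epsChain_of_forall_chainStep (hT : 0 < T) {δ : ℝ} {g : ℝ≥0 → X}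
    (hg : ∀ a t : ℝ≥0, T ≤ t → t ≤ 2 * T → ChainStep f T δ (g a) (g (a + t)))
    (a : ℝ≥0) {t : ℝ≥0} (ht : T ≤ t) : EpsChain f T δ (g a) (g (a + t)) := by
  obtain ⟨n, hn⟩ := Archimedean.arch t hT
  induction n generalizing a t with
  | zero => exact .single (hg a t ht (hn.trans (by simp)))
  | succ n ih =>
    rcases le_total t (2 * T) with h | h
    · exact .single (hg a t ht h)
    · obtain ⟨r, rfl⟩ := exists_add_of_le ht
      rw [two_mul, add_le_add_iff_left] at h
      rw [succ_nsmul', add_le_add_iff_left] at hn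
      rw [← add_assoc]
      exact .head (hg a T le_rfl (by rw [two_mul]; exact le_self_add)) (ih (a + T) h hn)

theorem eventually_epsChain_perturb [CompactSpace X] (f : Flow ℝ≥0 X) (T : ℝ≥0) {δ : ℝ}
    (hδ : 0 < δ) :
    ∀ᶠ η in 𝓝[>] 0, ∀ x x' y y' : X, dist x x' < η → dist y y' < η → EpsChain f T η x y →
      EpsChain f T δ x' y' := by
  filter_upwards [eventually_dist_flow_lt f (2 * T) (half_pos hδ),
    Ioo_mem_nhdsGT (show 0 < δ / 4 by linarith)] with η hη hηδ x x' y y' hx hy h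
  exact Relation.TransGen.mono (ChainStep.mono (by linarith [hηδ.2])) _ _
    ((h.of_dist_right_lt hy).of_dist_left_lt hη hx)

theorem isClosed_chainReach [CompactSpace X] (f : Flow ℝ≥0 X) (T : ℝ≥0) :
    IsClosed {p : X × X | ChainReach f T p.1 p.2} := by
  refine isClosed_of_closure_subset fun p hp δ hδ => ?_
  obtain ⟨η, hη, hη₀⟩ := ((eventually_epsChain_perturb f T hδ).and self_mem_nhdsWithin).exists
  obtain ⟨q, hq, hpq⟩ := Metric.mem_closure_iff.1 hp η hη₀
  rw [dist_comm, Prod.dist_eq, max_lt_iff] at hpq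
  exact hη _ _ _ _ hpq.1 hpq.2 (hq η hη₀)

theorem chainReach_of_isPreconnected [CompactSpace X] {S : Set X} (hS : IsPreconnected S)
    (hrec : ∀ x ∈ S, ChainReach f T x x) {p q : X} (hp : p ∈ S) (hq : q ∈ S) :
    ChainReach f T p q := by
  intro δ hδ
  obtain ⟨η, hη, hη₀⟩ := ((eventually_epsChain_perturb f T hδ).and self_mem_nhdsWithin).exists
  refine hS.induction₂' (EpsChain f T δ) (fun x hx => ?_)
    (fun _ _ _ _ _ _ => Relation.TransGen.trans) hp hq
  filter_upwards [mem_nhdsWithin_of_mem_nhds (Metric.ball_mem_nhds x hη₀)] with y hy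
  have hxx : dist x x < η := by rwa [dist_self]
  have hxy : dist x y < η := by rwa [dist_comm]
  exact ⟨hη x x x y hxx hxy (hrec x hx η hη₀), hη x y x x hxy hxx (hrec x hx η hη₀)⟩

end Chains

section MotionsAndChains

variable [CompactSpace X]

theorem eventually_chainStep_of_isEpsMotion (f : Flow ℝ≥0 X) (T : ℝ≥0) {δ : ℝ} (hδ : 0 < δ) :
    ∀ᶠ ε in 𝓝[>] 0, ∀ (x : X) (g : ℝ≥0 → X), IsEpsMotion f T ε x g →
      ∀ a t : ℝ≥0, T ≤ t → t ≤ 2 * T → ChainStep f T δ (g a) (g (a + t)) := by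
  filter_upwards [eventually_dist_flow_lt f T (half_pos hδ), Ioo_mem_nhdsGT (half_pos hδ)]
    with ε hε hεδ x g hg a t hTt htT
  refine ⟨t, hTt, htT, ?_⟩
  obtain ⟨r, rfl⟩ := exists_add_of_le hTt
  have hr : r ≤ T := by simpa [two_mul] using htT
  calc dist (f (T + r) (g a)) (g (a + (T + r)))
      = dist (g (a + T + r)) (f r (f T (g a))) := by
        rw [dist_comm, ← f.map_add, add_comm r T, add_assoc]
    _ ≤ dist (g (a + T + r)) (f r (g (a + T))) + dist (f r (g (a + T))) (f r (f T (g a))) :=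
        dist_triangle _ _ _
    _ < δ := by linarith [hg.2 (a + T) r hr, hε r hr _ _ (hg.2 a T le_rfl), hεδ.2]

theorem eventually_epsChain_of_isEpsMotion (f : Flow ℝ≥0 X) (hT : 0 < T) {δ : ℝ} (hδ : 0 < δ) :
    ∀ᶠ ε in 𝓝[>] 0, ∀ (x : X) (g : ℝ≥0 → X), IsEpsMotion f T ε x g →
      ∀ a b : ℝ≥0, a + T ≤ b → EpsChain f T δ (g a) (g b) := by
  filter_upwards [eventually_chainStep_of_isEpsMotion f T hδ] with ε hε x g hg a b hab
  obtain ⟨r, rfl⟩ := exists_add_of_le hab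
  rw [add_assoc]
  exact epsChain_of_forall_chainStep hT (hε x g hg) a le_self_add

theorem chainReach_flow (hT : 0 < T) {t : ℝ≥0} (ht : T ≤ t) (x : X) :
    ChainReach f T x (f t x) := by
  intro δ hδ
  obtain ⟨ε, hε, hε₀⟩ :=
    ((eventually_epsChain_of_isEpsMotion f hT hδ).and self_mem_nhdsWithin).exists
  simpa using hε x _ (isEpsMotion_orbit hε₀ x) 0 t (by simpa using ht)

theorem eventually_epsChain_of_mem_limitPoints (f : Flow ℝ≥0 X) (hT : 0 < T) {δ : ℝ}
    (hδ : 0 < δ) :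
    ∀ᶠ ε in 𝓝[>] 0, ∀ (x : X) (g : ℝ≥0 → X), IsEpsMotion f T ε x g → ∀ y ∈ limitPoints g,
      EpsChain f T δ y y ∧ ∀ a, EpsChain f T δ (g a) y := by
  obtain ⟨η, hη, hη₀⟩ := ((eventually_epsChain_perturb f T hδ).and self_mem_nhdsWithin).exists
  filter_upwards [eventually_epsChain_of_isEpsMotion f hT hη₀] with ε hε x g hg y hy
  have visit : ∀ a, ∃ b, a ≤ b ∧ dist (g b) y < η :=
    frequently_atTop.1 (frequently_dist_lt_of_mem_limitPoints hy hη₀)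
  constructor
  · obtain ⟨b, -, hb⟩ := visit 0
    obtain ⟨c, hbc, hc⟩ := visit (b + T)
    exact hη _ _ _ _ hb hc (hε x g hg b c hbc)
  · intro a
    obtain ⟨b, hab, hb⟩ := visit (a + T)
    exact hη _ _ _ _ (by rwa [dist_self]) hb (hε x g hg a b hab)

theorem chainReach_self_of_forall_mem_closure (hT : 0 < T) {y : X}
    (h : ∀ ε > 0, y ∈ closure (totalOmegaEps f T ε)) : ChainReach f T y y := by
  intro δ hδ
  obtain ⟨η, hη, hη₀⟩ := ((eventually_epsChain_perturb f T hδ).and self_mem_nhdsWithin).exists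
  obtain ⟨ε, hε, hε₀⟩ :=
    ((eventually_epsChain_of_mem_limitPoints f hT hη₀).and self_mem_nhdsWithin).exists
  obtain ⟨w, hw, hyw⟩ := Metric.mem_closure_iff.1 (h ε hε₀) η hη₀
  obtain ⟨x, g, hg, hwg⟩ := Set.mem_iUnion.1 hw
  rw [dist_comm] at hyw
  exact hη w y w y hyw hyw (hε x g hg w hwg).1

theorem chainReach_of_forall_mem_closure (hT : 0 < T) {x y : X}
    (h : ∀ ε > 0, y ∈ closure (omegaEps f T ε x)) : ChainReach f T x y ∧ ChainReach f T y y := by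
  refine ⟨fun δ hδ => ?_, chainReach_self_of_forall_mem_closure hT fun ε hε =>
    closure_mono (omegaEps_subset_totalOmegaEps ε x) (h ε hε)⟩
  obtain ⟨η, hη, hη₀⟩ := ((eventually_epsChain_perturb f T hδ).and self_mem_nhdsWithin).exists
  obtain ⟨ε, hε, hε₀⟩ :=
    ((eventually_epsChain_of_mem_limitPoints f hT hη₀).and self_mem_nhdsWithin).exists
  obtain ⟨w, ⟨g, hg, hwg⟩, hyw⟩ := Metric.mem_closure_iff.1 (h ε hε₀) η hη₀
  refine hη x x w y (by rwa [dist_self]) (by rwa [dist_comm]) ?_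
  simpa only [hg.1] using (hε x g hg w hwg).2 0

theorem chainReach_flow_of_mem_omegaZero (hT : 0 < T) {x y : X} (h : y ∈ omegaZero f T x) :
    ChainReach f T (f T x) y := by
  intro δ hδ
  obtain ⟨η, hη, hη₀⟩ := ((eventually_epsChain_perturb f T hδ).and self_mem_nhdsWithin).exists
  obtain ⟨ε, hε, hεη⟩ :=
    ((eventually_epsChain_of_mem_limitPoints f hT hη₀).and (Ioo_mem_nhdsGT hη₀)).exists
  obtain ⟨g, hg, hyg⟩ := h ε hεη.1
  have hgT : dist (g T) (f T x) < ε := by simpa [hg.1] using hg.2 0 T le_rfl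
  exact hη (g T) (f T x) y y (hgT.trans hεη.2) (by rwa [dist_self]) ((hε x g hg y hyg).2 T)

theorem eventually_exists_isEpsMotion_of_chainSteps (f : Flow ℝ≥0 X) (hT : 0 < T) {ε : ℝ}
    (hε : 0 < ε) :
    ∀ᶠ δ in 𝓝[>] 0, ∀ z : ℕ → X, (∀ i, ChainStep f T δ (z i) (z (i + 1))) →
      ∃ (g : ℝ≥0 → X) (s : ℕ → ℝ≥0), IsEpsMotion f T ε (z 0) g ∧ Tendsto s atTop atTop ∧
        ∀ n, g (s n) = z n := by
  filter_upwards [eventually_dist_flow_lt f T hε] with δ hδ z hz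
  choose t hTt _ hd using hz
  let s : ℕ → ℝ≥0 := fun n => ∑ i ∈ Finset.range n, t i
  have hs_succ (n) : s (n + 1) = s n + t n := Finset.sum_range_succ _ _
  have hsT (n) : s n + T ≤ s (n + 1) := by
    rw [hs_succ]
    gcongr
    exact hTt n
  have hs : Tendsto s atTop atTop :=
    tendsto_atTop_mono (fun n => by
      simpa using Finset.card_nsmul_le_sum (Finset.range n) t T fun i _ => hTt i)
      (tendsto_id.atTop_nsmul_const hT)
  have : Nonempty X := ⟨z 0⟩
  obtain ⟨g, hg⟩ := exists_eqOn_Ico (monotone_nat_of_le_succ fun n => le_self_add.trans (hsT n))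
    fun n u => f (u - s n) (z n)
  refine ⟨g, s, isEpsMotion_of_jumps hT hε hδ rfl hsT hs (fun n => ?_) hg, hs, fun n => ?_⟩
  · simpa [hs_succ] using hd n
  · have hn : s n ∈ Set.Ico (s n) (s (n + 1)) :=
      ⟨le_rfl, (lt_add_of_pos_right _ hT).trans_le (hsT n)⟩
    simpa [f.map_zero_apply] using hg n hn

theorem mem_omegaZero_iff (hT : 0 < T) {x y : X} :
    y ∈ omegaZero f T x ↔ ChainReach f T x y ∧ ChainReach f T y y := by
  constructor
  · exact fun h => chainReach_of_forall_mem_closure hT fun ε hε => subset_closure (h ε hε)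
  · rintro ⟨hxy, hyy⟩ ε hε
    obtain ⟨δ, hδ, hδ₀⟩ := ((eventually_exists_isEpsMotion_of_chainSteps f hT hε).and
      self_mem_nhdsWithin).exists
    obtain ⟨z, rfl, hz, hfreq⟩ := exists_seq_frequently_eq (hxy δ hδ₀) (hyy δ hδ₀)
    obtain ⟨g, s, hg, hs, hgs⟩ := hδ z hz
    obtain ⟨φ, hφ, hzφ⟩ := extraction_of_frequently_atTop hfreq
    exact ⟨g, hg, s ∘ φ, hs.comp hφ.tendsto_atTop, by simp [hgs, hzφ]⟩

theorem mem_totalOmegaZero_iff (hT : 0 < T) {y : X} :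
    y ∈ totalOmegaZero f T ↔ ChainReach f T y y := by
  simp only [totalOmegaZero, Set.mem_iUnion, mem_omegaZero_iff hT]
  exact ⟨fun ⟨_, _, h⟩ => h, fun h => ⟨y, h, h⟩⟩

theorem omegaZero_subset_omegaZero_flow (hT : 0 < T) (x : X) :
    omegaZero f T x ⊆ omegaZero f T (f T x) := fun _ hy =>
  (mem_omegaZero_iff hT).2 ⟨chainReach_flow_of_mem_omegaZero hT hy, ((mem_omegaZero_iff hT).1 hy).2⟩

theorem isClosed_totalOmegaZero (hT : 0 < T) : IsClosed (totalOmegaZero f T) := by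
  have hdiag : totalOmegaZero f T = {y | ChainReach f T y y} :=
    Set.ext fun _ => mem_totalOmegaZero_iff hT
  rw [hdiag]
  exact (isClosed_chainReach f T).preimage (f := fun y => (y, y)) (by fun_prop)

theorem eventually_disjoint_omegaEps (hT : 0 < T) {K : Set X} (hK : IsCompact K) {x : X}
    (h : Disjoint K (omegaZero f T x)) : ∀ᶠ ε in 𝓝[>] 0, Disjoint K (omegaEps f T ε x) := by
  refine eventually_disjoint_of_isCompact (omegaEps_mono x) hK fun p hp => ?_
  by_contra! hcl
  exact Set.disjoint_left.1 h hp
    ((mem_omegaZero_iff hT).2 (chainReach_of_forall_mem_closure hT hcl))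

theorem eventually_disjoint_totalOmegaEps (hT : 0 < T) {K : Set X} (hK : IsCompact K)
    (h : Disjoint K (totalOmegaZero f T)) :
    ∀ᶠ ε in 𝓝[>] 0, Disjoint K (totalOmegaEps f T ε) := by
  refine eventually_disjoint_of_isCompact totalOmegaEps_mono hK fun p hp => ?_
  by_contra! hcl
  exact Set.disjoint_left.1 h hp
    ((mem_totalOmegaZero_iff hT).2 (chainReach_self_of_forall_mem_closure hT hcl))

theorem totalOmegaZero_subset_omegaZero (hT : 0 < T) (hc : IsPreconnected (totalOmegaZero f T))
    (x : X) : totalOmegaZero f T ⊆ omegaZero f T x := by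
  intro c hcm
  obtain ⟨p, hp⟩ := omegaZero_nonempty f T x
  have hxp := ((mem_omegaZero_iff hT).1 hp).1
  have hpc := chainReach_of_isPreconnected hc (fun _ => (mem_totalOmegaZero_iff hT).1)
    (Set.mem_iUnion_of_mem x hp) hcm
  exact (mem_omegaZero_iff hT).2 ⟨hxp.trans hpc, (mem_totalOmegaZero_iff hT).1 hcm⟩

end MotionsAndChains

section BackwardOrbits

/-- A complete backward orbit of `z 0`, sampled at the times `-k T`. -/
def IsBackwardOrbit (f : Flow ℝ≥0 X) (T : ℝ≥0) (z : ℕ → X) : Prop :=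
  ∀ k, f T (z (k + 1)) = z k

/-- The global attractor of a semiflow on a compact space: the states that can be reached after
arbitrarily long times. -/
def globalAttractor (f : Flow ℝ≥0 X) : Set X :=
  ⋂ t, Set.range (f t)

theorem IsBackwardOrbit.flow_mul {z : ℕ → X} (hz : IsBackwardOrbit f T z) (m k : ℕ) :
    f (m * T) (z (k + m)) = z k := by
  induction m generalizing k with
  | zero => simp [f.map_zero_apply]
  | succ m ih =>
    rw [Nat.cast_succ, add_one_mul, add_comm (m * T), f.map_add, ← add_assoc,
      add_right_comm, ih, hz]

theorem exists_isBackwardOrbit_of_tendsto [CompactSpace X] {ι : Type*} {U : Ultrafilter ι}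
    {ε : ι → ℝ} {x : ι → X} {g : ι → ℝ≥0 → X} {s : ι → ℝ≥0} {y : X} (hε : Tendsto ε U (𝓝 0))
    (hg : ∀ i, IsEpsMotion f T (ε i) (x i) (g i)) (hs : Tendsto s U atTop)
    (hy : Tendsto (fun i => g i (s i)) U (𝓝 y)) : ∃ z, IsBackwardOrbit f T z ∧ z 0 = y := by
  have hlim (k : ℕ) : ∃ w, Tendsto (fun i => g i (s i - k * T)) U (𝓝 w) := by
    obtain ⟨w, -, hw⟩ := isCompact_univ.ultrafilter_le_nhds (U.map fun i => g i (s i - k * T))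
      (by simp)
    exact ⟨w, hw⟩
  choose z hz using hlim
  refine ⟨z, fun k => ?_, tendsto_nhds_unique (hz 0) (by simpa using hy)⟩
  have hflow : Tendsto (fun i => f T (g i (s i - (k + 1 : ℕ) * T))) U (𝓝 (f T (z (k + 1)))) :=
    ((f.continuous continuous_const continuous_id).tendsto _).comp (hz (k + 1))
  refine tendsto_nhds_unique hflow ((tendsto_iff_of_dist ?_).1 (hz k))
  refine squeeze_zero' (Eventually.of_forall fun _ => dist_nonneg) ?_ hε
  filter_upwards [hs.eventually_ge_atTop ((k + 1 : ℕ) * T)] with i hi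
  have htime : s i - (k + 1 : ℕ) * T + T = s i - k * T := by
    rw [Nat.cast_succ, add_one_mul] at hi ⊢
    rw [tsub_add_eq_add_tsub hi, add_tsub_add_eq_tsub_right]
  simpa only [htime] using ((hg i).2 (s i - (k + 1 : ℕ) * T) T le_rfl).le

theorem antitone_range_flow (f : Flow ℝ≥0 X) : Antitone fun t => Set.range (f t) := by
  rintro s t hst _ ⟨x, rfl⟩
  obtain ⟨r, rfl⟩ := exists_add_of_le hst
  exact ⟨f r x, by rw [f.map_add]⟩

variable [CompactSpace X]

theorem isConnected_globalAttractor [ConnectedSpace X] (f : Flow ℝ≥0 X) :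
    IsConnected (globalAttractor f) :=
  have hcont (t : ℝ≥0) : Continuous (f t) := f.continuous continuous_const continuous_id
  isConnected_iInter_of_directed (antitone_range_flow f).directed_ge
    (fun t => isCompact_range (hcont t)) fun t => isConnected_range (hcont t)

theorem mem_globalAttractor_iff (hT : 0 < T) {y : X} :
    y ∈ globalAttractor f ↔ ∃ z, IsBackwardOrbit f T z ∧ z 0 = y := by
  constructor
  · intro hy
    choose x hx using fun j : ℕ => Set.mem_iInter.1 hy (j * T)
    refine exists_isBackwardOrbit_of_tendsto (U := .of atTop)
      (tendsto_one_div_add_atTop_nhds_zero_nat.mono_left (Ultrafilter.of_le _))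
      (fun j => isEpsMotion_orbit Nat.one_div_pos_of_nat (x j))
      ((tendsto_natCast_atTop_atTop.atTop_mul_const hT).mono_left (Ultrafilter.of_le _)) ?_
    simp only [hx, tendsto_const_nhds]
  · rintro ⟨z, hz, rfl⟩
    refine Set.mem_iInter.2 fun t => ?_
    obtain ⟨n, hn⟩ := Archimedean.arch t hT
    exact antitone_range_flow f (hn.trans_eq (nsmul_eq_mul n T)) ⟨z (0 + n), hz.flow_mul n 0⟩

theorem totalOmegaZero_subset_globalAttractor (hT : 0 < T) :
    totalOmegaZero f T ⊆ globalAttractor f := by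
  intro y hy
  obtain ⟨x, hx⟩ := Set.mem_iUnion.1 hy
  choose g hg hlim using fun j : ℕ => hx (1 / (j + 1)) Nat.one_div_pos_of_nat
  choose s hs hsy using fun j : ℕ => frequently_atTop.1
    (frequently_dist_lt_of_mem_limitPoints (hlim j) (Nat.one_div_pos_of_nat (n := j))) j
  have hgs : Tendsto (fun j => g j (s j)) atTop (𝓝 y) :=
    tendsto_iff_dist_tendsto_zero.2 (squeeze_zero (fun _ => dist_nonneg) (fun j => (hsy j).le)
      tendsto_one_div_add_atTop_nhds_zero_nat)
  exact (mem_globalAttractor_iff hT).2 (exists_isBackwardOrbit_of_tendsto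
    (tendsto_one_div_add_atTop_nhds_zero_nat.mono_left (Ultrafilter.of_le _)) hg
    ((tendsto_atTop_mono hs tendsto_natCast_atTop_atTop).mono_left (Ultrafilter.of_le _))
    (hgs.mono_left (Ultrafilter.of_le _)))

theorem exists_isBackwardOrbit_notMem_totalOmegaZero [ConnectedSpace X] (hT : 0 < T)
    (hc : ¬ IsConnected (totalOmegaZero f T)) :
    ∃ z, IsBackwardOrbit f T z ∧ z 0 ∉ totalOmegaZero f T := by
  by_contra! hmem
  have hsub : globalAttractor f ⊆ totalOmegaZero f T := fun y hy => by
    obtain ⟨z, hz, rfl⟩ := (mem_globalAttractor_iff hT).1 hy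
    exact hmem z hz
  rw [(totalOmegaZero_subset_globalAttractor hT).antisymm hsub] at hc
  exact hc (isConnected_globalAttractor f)

theorem IsBackwardOrbit.chainReach {z : ℕ → X} (hz : IsBackwardOrbit f T z) (hT : 0 < T) {k l : ℕ}
    (h : k < l) : ChainReach f T (z l) (z k) := by
  obtain ⟨m, rfl⟩ := Nat.exists_eq_add_of_lt h
  rw [← hz.flow_mul (m + 1) k]
  refine chainReach_flow hT ?_ _
  rw [Nat.cast_succ, add_one_mul]
  exact le_add_self

theorem IsBackwardOrbit.omegaZero_subset {z : ℕ → X} (hz : IsBackwardOrbit f T z) (hT : 0 < T)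
    (k : ℕ) : omegaZero f T (z k) ⊆ omegaZero f T (z 0) := by
  refine antitone_nat_of_succ_le (f := fun k => omegaZero f T (z k)) (fun k => ?_) k.zero_le
  simpa only [hz k] using omegaZero_subset_omegaZero_flow (f := f) hT (z (k + 1))

theorem IsBackwardOrbit.mem_totalOmegaZero {z : ℕ → X} (hz : IsBackwardOrbit f T z) (hT : 0 < T)
    (hc : IsPreconnected (totalOmegaZero f T)) : z 0 ∈ totalOmegaZero f T := by
  obtain ⟨q, φ, hφ, hq⟩ := CompactSpace.tendsto_subseq z
  have hq0 : ChainReach f T q (z 0) := by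
    refine (isClosed_chainReach f T).mem_of_tendsto (hq.prodMk_nhds tendsto_const_nhds) ?_
    filter_upwards [hφ.tendsto_atTop.eventually_gt_atTop 0] with n hn
    exact hz.chainReach hT hn
  have hqq : ChainReach f T q q :=
    (isClosed_chainReach f T).mem_of_tendsto ((hq.comp (tendsto_add_atTop_nat 1)).prodMk_nhds hq)
      (Eventually.of_forall fun n => hz.chainReach hT (hφ n.lt_succ_self))
  have h0q : ChainReach f T (z 0) q := ((mem_omegaZero_iff hT).1
    (totalOmegaZero_subset_omegaZero hT hc (z 0) ((mem_totalOmegaZero_iff hT).2 hqq))).1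
  exact (mem_totalOmegaZero_iff hT).2 (h0q.trans hq0)

end BackwardOrbits

section RelaxationTimes

theorem le_firstEntry {g : ℝ≥0 → X} {W : Set X} {γ : ℝ} {t : ℝ≥0}
    (h : ∀ s < t, γ ≤ Metric.infDist (g s) W) : (t : ℝ≥0∞) ≤ firstEntry g W γ :=
  le_iInf₂ fun s hs => ENNReal.coe_le_coe.2 (le_of_not_gt fun hst => (h s hst).not_gt hs)

theorem le_finalEntry {g : ℝ≥0 → X} {W : Set X} {γ : ℝ} {t : ℝ≥0}
    (h : γ ≤ Metric.infDist (g t) W) : (t : ℝ≥0∞) ≤ finalEntry g W γ :=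
  le_iInf₂ fun _ hs => ENNReal.coe_le_coe.2 (le_of_not_gt fun hst => (hs t hst).not_ge h)

theorem exists_lt_of_lt_finalEntry {g : ℝ≥0 → X} {W : Set X} {γ : ℝ} {t : ℝ≥0}
    (h : (t : ℝ≥0∞) < finalEntry g W γ) : ∃ s, t < s ∧ γ ≤ Metric.infDist (g s) W := by
  contrapose! h
  exact iInf₂_le t h

theorem firstEntry_le_timeOutside (g : ℝ≥0 → X) (W : Set X) (γ : ℝ) :
    firstEntry g W γ ≤ timeOutside g W γ := by
  refine ENNReal.le_of_forall_nnreal_lt fun t ht => ?_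
  have hsub : Set.Ico (0 : ℝ) t ⊆
      (fun t : ℝ≥0 => (t : ℝ)) '' {t | γ ≤ Metric.infDist (g t) W} := by
    rintro r ⟨hr0, hrt⟩
    lift r to ℝ≥0 using hr0
    refine ⟨r, le_of_not_gt (α := ℝ) fun hr => ?_, rfl⟩
    have hle : firstEntry g W γ ≤ r := iInf₂_le r hr
    exact ((ENNReal.coe_lt_coe.2 hrt).trans ht).not_ge hle
  simpa [timeOutside] using MeasureTheory.measure_mono (μ := MeasureTheory.volume) hsub

theorem timeOutside_le_finalEntry (g : ℝ≥0 → X) (W : Set X) (γ : ℝ) :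
    timeOutside g W γ ≤ finalEntry g W γ := by
  refine le_iInf₂ fun t ht => ?_
  have hsub : (fun t : ℝ≥0 => (t : ℝ)) '' {t | γ ≤ Metric.infDist (g t) W} ⊆
      Set.Icc (0 : ℝ) t := by
    rintro _ ⟨r, hr, rfl⟩
    exact ⟨r.2, le_of_not_gt fun htr => (ht r htr).not_ge hr⟩
  simpa [timeOutside] using MeasureTheory.measure_mono (μ := MeasureTheory.volume) hsub

theorem finalEntry_totalOmegaEps_le {g : ℝ≥0 → X} {γ ε : ℝ} {x : X}
    (hne : (omegaEps f T ε x).Nonempty) :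
    finalEntry g (totalOmegaEps f T ε) γ ≤ finalEntry g (omegaEps f T ε x) γ :=
  le_iInf₂ fun t ht => iInf₂_le t fun s hs =>
    (Metric.infDist_le_infDist_of_subset (omegaEps_subset_totalOmegaEps ε x) hne).trans_lt (ht s hs)

theorem SlowRelaxations.mono {R R' : ℝ → X → (ℝ≥0 → X) → ℝ → ℝ≥0∞}
    (h : ∀ ε x g γ, 0 < ε → R ε x g γ ≤ R' ε x g γ) (hR : SlowRelaxations f T R) :
    SlowRelaxations f T R' := by
  obtain ⟨γ, hγ, ε, x, g, hε, hε0, hg, hlim⟩ := hR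
  exact ⟨γ, hγ, ε, x, g, hε, hε0, hg, tendsto_nhds_top_mono' hlim fun j => h _ _ _ _ (hε j)⟩

theorem TauOneSlow.tauTwoSlow (h : TauOneSlow f T) : TauTwoSlow f T :=
  SlowRelaxations.mono (fun _ _ _ _ _ => firstEntry_le_timeOutside _ _ _) h

theorem TauTwoSlow.tauThreeSlow (h : TauTwoSlow f T) : TauThreeSlow f T :=
  SlowRelaxations.mono (fun _ _ _ _ _ => timeOutside_le_finalEntry _ _ _) h

theorem EtaThreeSlow.tauThreeSlow [CompactSpace X] (h : EtaThreeSlow f T) : TauThreeSlow f T :=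
  SlowRelaxations.mono (fun _ x _ _ hε => finalEntry_totalOmegaEps_le (omegaEps_nonempty hε x)) h

theorem SlowRelaxations.exists_late_times {W : ℝ → X → Set X}
    (h : SlowRelaxations f T fun ε x g γ => finalEntry g (W ε x) γ) :
    ∃ γ : ℝ, 0 < γ ∧ ∃ (ε : ℕ → ℝ) (x : ℕ → X) (g : ℕ → ℝ≥0 → X) (s : ℕ → ℝ≥0),
      (∀ j, 0 < ε j) ∧ Tendsto ε atTop (𝓝 0) ∧ (∀ j, IsEpsMotion f T (ε j) (x j) (g j)) ∧
      Tendsto s atTop atTop ∧ ∀ j, γ ≤ Metric.infDist (g j (s j)) (W (ε j) (x j)) := by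
  obtain ⟨γ, hγ, ε, x, g, hε, hε0, hg, hlim⟩ := h
  obtain ⟨φ, hφ, hlate⟩ := extraction_forall_of_eventually fun n : ℕ =>
    hlim.eventually (lt_mem_nhds (ENNReal.coe_lt_top (r := (n : ℝ≥0))))
  choose s hs hd using fun n => exists_lt_of_lt_finalEntry (hlate n)
  exact ⟨γ, hγ, ε ∘ φ, x ∘ φ, g ∘ φ, s, fun _ => hε _, hε0.comp hφ.tendsto_atTop, fun _ => hg _,
    tendsto_atTop_mono (fun n => (hs n).le) tendsto_natCast_atTop_atTop, hd⟩

theorem slowRelaxations_of_orbits {R : ℝ → X → (ℝ≥0 → X) → ℝ → ℝ≥0∞} {γ : ℝ} (hγ : 0 < γ)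
    {z : ℕ → X} {t : ℕ → ℝ≥0} (ht : Tendsto t atTop atTop)
    (hR : ∀ j, ∀ᶠ ε in 𝓝[>] 0, (t j : ℝ≥0∞) ≤ R ε (z j) (fun s => f s (z j)) γ) :
    SlowRelaxations f T R := by
  choose ε hε hεj using fun j : ℕ =>
    ((hR j).and (Ioo_mem_nhdsGT (Nat.one_div_pos_of_nat (α := ℝ) (n := j)))).exists
  exact ⟨γ, hγ, ε, z, fun j s => f s (z j), fun j => (hεj j).1,
    squeeze_zero (fun j => (hεj j).1.le) (fun j => (hεj j).2.le)
      tendsto_one_div_add_atTop_nhds_zero_nat,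
    fun j => isEpsMotion_orbit (hεj j).1 (z j),
    tendsto_nhds_top_mono' (ENNReal.tendsto_coe_nhds_top.2 ht) hε⟩

variable [CompactSpace X]

theorem not_tauThreeSlow (hT : 0 < T) (hc : IsPreconnected (totalOmegaZero f T)) :
    ¬ TauThreeSlow f T := by
  intro h
  obtain ⟨γ, hγ, ε, x, g, s, hε, hε0, hg, hs, hd⟩ := h.exists_late_times
  have hU := Ultrafilter.of_le (atTop : Filter ℕ)
  set U := Ultrafilter.of (atTop : Filter ℕ)
  obtain ⟨y, -, hy⟩ := isCompact_univ.ultrafilter_le_nhds (U.map fun j => g j (s j)) (by simp)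
  obtain ⟨z, hz, rfl⟩ := exists_isBackwardOrbit_of_tendsto (hε0.mono_left hU) hg
    (hs.mono_left hU) hy
  obtain ⟨j, hj⟩ := (Tendsto.eventually hy (Metric.ball_mem_nhds (z 0) hγ)).exists
  have hz0 : z 0 ∈ omegaEps f T (ε j) (x j) :=
    totalOmegaZero_subset_omegaZero hT hc (x j) (hz.mem_totalOmegaZero hT hc) (ε j) (hε j)
  exact ((hd j).trans (Metric.infDist_le_dist_of_mem hz0)).not_gt hj

theorem etaThreeSlow_of_isBackwardOrbit (hT : 0 < T) {z : ℕ → X} (hz : IsBackwardOrbit f T z)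
    (h0 : z 0 ∉ totalOmegaZero f T) : EtaThreeSlow f T := by
  obtain ⟨γ, hγ, hd⟩ := (Set.disjoint_singleton_left.2 h0).exists_cthickenings isCompact_singleton
    (isClosed_totalOmegaZero hT)
  have hdisj := eventually_disjoint_totalOmegaEps hT Metric.isClosed_cthickening.isCompact
    (hd.mono_right (Metric.self_subset_cthickening _))
  refine slowRelaxations_of_orbits hγ (z := z)
    (tendsto_natCast_atTop_atTop.atTop_mul_const hT) fun j => ?_
  filter_upwards [hdisj, self_mem_nhdsWithin] with ε hε hε₀
  refine le_finalEntry (le_infDist_of_disjoint_cthickening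
    ((omegaEps_nonempty hε₀ (z 0)).mono (omegaEps_subset_totalOmegaEps ε _)) hε ?_)
  simpa using hz.flow_mul j 0

theorem tauOneSlow_of_isBackwardOrbit (hT : 0 < T) {z : ℕ → X} (hz : IsBackwardOrbit f T z)
    (h0 : z 0 ∉ totalOmegaZero f T) : TauOneSlow f T := by
  have hto : IsClosed {p | ChainReach f T p (z 0)} :=
    (isClosed_chainReach f T).preimage (f := fun p => (p, z 0)) (by fun_prop)
  have hfrom : IsClosed {p | ChainReach f T (z 0) p} :=
    (isClosed_chainReach f T).preimage (f := fun p => (z 0, p)) (by fun_prop)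
  have hdisj : Disjoint {p | ChainReach f T p (z 0)} {p | ChainReach f T (z 0) p} :=
    Set.disjoint_left.2 fun p hp0 h0p => h0 ((mem_totalOmegaZero_iff hT).2 (h0p.trans hp0))
  obtain ⟨γ, hγ, hd⟩ := hdisj.exists_cthickenings hto.isCompact hfrom
  have hsub (k : ℕ) : omegaZero f T (z k) ⊆ {p | ChainReach f T (z 0) p} := fun p hp =>
    ((mem_omegaZero_iff hT).1 (hz.omegaZero_subset hT k hp)).1
  have horbit (j : ℕ) {s : ℝ≥0} (hs : s < j * T) : ChainReach f T (f s (z (j + 1))) (z 0) := by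
    obtain ⟨r, hr⟩ := exists_add_of_le hs.le
    have htime : r + T + s = (j + 1 : ℕ) * T := by
      rw [Nat.cast_succ, add_one_mul, hr, add_comm, add_assoc]
    rw [← hz.flow_mul (j + 1) 0, ← htime, f.map_add, zero_add]
    exact chainReach_flow hT le_add_self _
  refine slowRelaxations_of_orbits hγ (z := fun j => z (j + 1))
    (tendsto_natCast_atTop_atTop.atTop_mul_const hT) fun j => ?_
  filter_upwards [eventually_disjoint_omegaEps hT Metric.isClosed_cthickening.isCompact
    (hd.mono_right ((hsub (j + 1)).trans (Metric.self_subset_cthickening _))),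
    self_mem_nhdsWithin] with ε hε hε₀
  exact le_firstEntry fun s hs =>
    le_infDist_of_disjoint_cthickening (omegaEps_nonempty hε₀ _) hε (horbit j hs)

end RelaxationTimes

end Perturbed

open Perturbed in
theorem theorem4p6_general {X : Type*} [MetricSpace X] [CompactSpace X] [ConnectedSpace X]
    (f : Flow ℝ≥0 X) (T : ℝ≥0) (hT : 0 < T) :
    (IsConnected (totalOmegaZero f T) →
      ¬ TauOneSlow f T ∧ ¬ TauTwoSlow f T ∧ ¬ TauThreeSlow f T ∧ ¬ EtaThreeSlow f T) ∧
    (¬ IsConnected (totalOmegaZero f T) →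
      TauOneSlow f T ∧ TauTwoSlow f T ∧ TauThreeSlow f T ∧ EtaThreeSlow f T) := by
  constructor
  · intro hc
    have h : ¬ TauThreeSlow f T := not_tauThreeSlow hT hc.isPreconnected
    exact ⟨fun h₁ => h h₁.tauTwoSlow.tauThreeSlow, fun h₂ => h h₂.tauThreeSlow, h,
      fun h₃ => h h₃.tauThreeSlow⟩
  · intro hc
    obtain ⟨z, hz, h0⟩ := exists_isBackwardOrbit_notMem_totalOmegaZero hT hc
    have h : TauOneSlow f T := tauOneSlow_of_isBackwardOrbit hT hz h0
    exact ⟨h, h.tauTwoSlow, h.tauTwoSlow.tauThreeSlow, etaThreeSlow_of_isBackwardOrbit hT hz h0⟩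

theorem theorem4p6 {X : Type*} [MetricSpace X] [CompactSpace X] [ConnectedSpace X]
    (f : Flow ℝ≥0 X) (hf : ∀ t : ℝ≥0, Function.Injective (f t))
    (T : ℝ≥0) (hT : 0 < T) :
    (IsConnected (Perturbed.totalOmegaZero f T) →
      ¬ Perturbed.TauOneSlow f T ∧ ¬ Perturbed.TauTwoSlow f T ∧
      ¬ Perturbed.TauThreeSlow f T ∧ ¬ Perturbed.EtaThreeSlow f T) ∧
    (¬ IsConnected (Perturbed.totalOmegaZero f T) →
      Perturbed.TauOneSlow f T ∧ Perturbed.TauTwoSlow f T ∧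
      Perturbed.TauThreeSlow f T ∧ Perturbed.EtaThreeSlow f T) :=
  theorem4p6_general f T hT
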